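/- Let $n$ be a positive integer and let $S_n$ be the symmetric group on $n$ letters. For distinct letters $a,b$ let $t_{a,b}\in S_n$ be the transposition interchanging $a$ and $b$, and for $\pi\in S_n$ let $\ell(\pi)$ be the least $k$ such that $\pi$ is a product of $k$ adjacent transpositions $t_{i,i+1}$ ($1\le i<n$). The strong Bruhat order on $S_n$ is the partial order in which $\sigma\le\pi$ if and only if there is a sequence $\sigma=\sigma_0,\sigma_1,\dots,\sigma_m=\pi$ ($m\ge 0$) in $S_n$ such that, for each $r$, $\sigma_{r}=t\,\sigma_{r-1}$ for some transposition $t$ and $\ell(\sigma_{r-1})<\ell(\sigma_{r})$. The down degree $d_-(\pi)$ is the number of permutations covered by $\pi$ in this order, that is, of those $\sigma<\pi$ for which there is no $\tau$ with $\sigma<\tau<\pi$. Theorem. The expected value of the down degree of a uniformly random permutation in $S_n$ is $$\frac1{n!}\sum_{\pi\in S_n} d_-(\pi)=\sum_{i=2}^n\sum_{j=2}^i\sum_{k=2}^j\frac{1}{i\,(k-1)}=(n+1)\sum_{i=1}^n\frac1i-2n .$$ -/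

import Mathlib

/-- The standard Coxeter generators `s_i = t_{i,i+1}` of the symmetric group on `n` letters
(the letters are `0, …, n - 1`). -/
def adjacentTranspositions (n : ℕ) : Set (Equiv.Perm (Fin n)) :=
  {s | ∃ i j : Fin n, i.val + 1 = j.val ∧ s = Equiv.swap i j}

/-- The length of `π`: the least `k` such that `π` is a product of `k` standard Coxeter
generators. -/
noncomputable def coxeterLength {n : ℕ} (π : Equiv.Perm (Fin n)) : ℕ :=
  sInf {k | ∃ w : List (Equiv.Perm (Fin n)),
    w.length = k ∧ (∀ s ∈ w, s ∈ adjacentTranspositions n) ∧ w.prod = π}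

/-- The Bruhat graph: an edge from `σ` to `t_{a,b} σ` whenever the latter is longer. -/
def BruhatStep {n : ℕ} (σ π : Equiv.Perm (Fin n)) : Prop :=
  ∃ a b : Fin n, π = Equiv.swap a b * σ ∧ coxeterLength σ < coxeterLength π

/-- The strict strong Bruhat order: `σ < π` if there is a nonempty directed path from `σ` to `π`
in the Bruhat graph. -/
def StrongBruhatLT {n : ℕ} (σ π : Equiv.Perm (Fin n)) : Prop :=
  Relation.TransGen BruhatStep σ π

/-- `π` covers `σ` in the strong Bruhat order. -/
def StrongBruhatCovers {n : ℕ} (π σ : Equiv.Perm (Fin n)) : Prop :=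
  StrongBruhatLT σ π ∧ ¬ ∃ τ : Equiv.Perm (Fin n), StrongBruhatLT σ τ ∧ StrongBruhatLT τ π

/-- The down degree of `π`: the number of permutations covered by `π` in the strong Bruhat
order. -/
noncomputable def downDegree {n : ℕ} (π : Equiv.Perm (Fin n)) : ℕ :=
  Set.ncard {σ : Equiv.Perm (Fin n) | StrongBruhatCovers π σ}

open scoped BigOperators

/-!
The length of a permutation is its number of inversions (`coxeterLength_eq_inversionCount`). If
positions `i < j` form an inversion of `π`, swapping them removes `1 + 2c` inversions, where `c` is
the number of positions `k` between `i` and `j` with `π j < π k < π i`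
(`inversionCount_eq_mul_swap`). Hence `π` covers exactly the permutations `π * swap i j` with
`i < j` and `c = 0`: if such a `k` exists, three length-decreasing swaps lead from `π` to
`π * swap i j`. So `downDegree π` counts the pairs `i < j` such that `π j` is immediately
below `π i` among the values of `π` on `Icc i j` (`downDegree_eq_sum`).

For a fixed set `S` of positions and distinct `a, b ∈ S`, the value `π b` is immediately below
`π a` within `π '' S` with probability `1 / #S` (`card_mul_card_isValuePredIn`). By symmetry `π a`
is the minimum on `S` with probability `1 / #S`; otherwise exactly one of the other `#S - 1`
positions carries the value immediately below, and these are equally likely.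

With `S = Icc i j` the expected down degree is `∑_{i < j} 1 / (j - i + 1)`. Grouping by `j` turns
this into `∑_{m = 1}^n (H_m - 1)`, where `H_m` is the harmonic number, which is
`(n + 1) H_n - 2 n`. The triple sum is the same sum of `H_m - 1`, because
`H_1 + ⋯ + H_{m-1} = m (H_m - 1)`.
-/

open Equiv Finset

/-! ### Inversions and transpositions -/

/-- The number of inversions of `π`: pairs of positions `a < b` with `π b < π a`. -/
def inversionCount {n : ℕ} (π : Perm (Fin n)) : ℕ :=
  #{p : Fin n × Fin n | p.1 < p.2 ∧ π p.2 < π p.1}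

theorem inversionCount_eq_sum {n : ℕ} (π : Perm (Fin n)) :
    (inversionCount π : ℤ) = ∑ a, ∑ b, if a < b ∧ π b < π a then 1 else 0 := by
  rw [inversionCount, card_filter, Fintype.sum_prod_type]
  push_cast
  rfl

theorem inversionCount_mul_swap_eq_sum {n : ℕ} (π : Perm (Fin n)) (i j : Fin n) :
    (inversionCount (π * swap i j) : ℤ) =
      ∑ a, ∑ b, if swap i j a < swap i j b ∧ π b < π a then 1 else 0 := by
  rw [inversionCount_eq_sum, ← Equiv.sum_comp (swap i j)]
  refine sum_congr rfl fun a _ => ?_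
  rw [← Equiv.sum_comp (swap i j)]
  simp

/-- Swapping the two positions of an inversion `i < j` removes that inversion, and two more for
each position strictly between `i` and `j` whose value lies strictly between `π j` and `π i`. -/
theorem inversionCount_eq_mul_swap {n : ℕ} (π : Perm (Fin n)) {i j : Fin n} (hij : i < j)
    (h : π j < π i) :
    inversionCount π = inversionCount (π * swap i j) + 1 +
      2 * #{k : Fin n | (i < k ∧ k < j) ∧ π j < π k ∧ π k < π i} := by
  -- Compare the two indicators of an inversion: they differ only if `a` or `b` is `i` or `j`.
  have key : ∀ a b : Fin n, ((if a < b ∧ π b < π a then 1 else 0 : ℤ)) =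
      (if swap i j a < swap i j b ∧ π b < π a then 1 else 0) +
      (if a = i then if b = j then 1 else 0 else 0) +
      (if a = i then if (i < b ∧ b < j) ∧ π b < π i then 1 else 0 else 0) -
      (if a = j then if (i < b ∧ b < j) ∧ π b < π j then 1 else 0 else 0) -
      (if b = i then if (i < a ∧ a < j) ∧ π i < π a then 1 else 0 else 0) +
      (if b = j then if (i < a ∧ a < j) ∧ π j < π a then 1 else 0 else 0) := by
    intro a b
    simp only [swap_apply_def]
    by_cases hai : a = i
    · subst hai
      by_cases hbj : b = j
      · subst hbj; grind
      · grind
    · by_cases haj : a = j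
      · subst haj; grind
      · grind
  -- Collect the four corrections attached to an intermediate position `k`.
  have hk : ∀ k : Fin n, (2 * if (i < k ∧ k < j) ∧ π j < π k ∧ π k < π i then 1 else 0 : ℤ) =
      (if (i < k ∧ k < j) ∧ π k < π i then 1 else 0) -
      (if (i < k ∧ k < j) ∧ π k < π j then 1 else 0) -
      (if (i < k ∧ k < j) ∧ π i < π k then 1 else 0) +
      (if (i < k ∧ k < j) ∧ π j < π k then 1 else 0) := by
    intro k
    have h1 : k ≠ i → π k ≠ π i := fun h => π.injective.ne h
    have h2 : k ≠ j → π k ≠ π j := fun h => π.injective.ne h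
    grind
  zify
  rw [inversionCount_eq_sum, inversionCount_mul_swap_eq_sum, card_filter]
  push_cast
  simp_rw [mul_sum, hk, key, sum_add_distrib, sum_sub_distrib, sum_add_distrib]
  have hswap : ∀ (c : Fin n) (f : Fin n → ℤ), ∑ a, ∑ b, (if a = c then f b else 0) = ∑ b, f b := by
    intro c f
    rw [sum_comm]
    simp
  simp only [hswap, sum_ite_eq', mem_univ, if_true]
  ring

theorem inversionCount_mul_swap_lt {n : ℕ} (π : Perm (Fin n)) {i j : Fin n} (hij : i < j)
    (h : π j < π i) : inversionCount (π * swap i j) < inversionCount π := by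
  have := inversionCount_eq_mul_swap π hij h
  omega

/-- Swapping two positions `i < j` shortens `π` exactly when they form an inversion. -/
theorem inversionCount_mul_swap_lt_iff {n : ℕ} (π : Perm (Fin n)) {i j : Fin n} (hij : i < j) :
    inversionCount (π * swap i j) < inversionCount π ↔ π j < π i := by
  refine ⟨fun h => ?_, inversionCount_mul_swap_lt π hij⟩
  by_contra hle
  have hlt : π i < π j := lt_of_le_of_ne (not_lt.mp hle) (π.injective.ne hij.ne)
  have := inversionCount_mul_swap_lt (π * swap i j) hij (by simpa using hlt)
  rw [mul_assoc, swap_mul_self, mul_one] at this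
  omega

/-- Swapping an adjacent descent removes exactly one inversion, there being no position between. -/
theorem inversionCount_mul_swap_of_descent {n : ℕ} (π : Perm (Fin n)) {i j : Fin n}
    (hij : i.val + 1 = j.val) (h : π j < π i) :
    inversionCount π = inversionCount (π * swap i j) + 1 := by
  have hempty : #{k : Fin n | (i < k ∧ k < j) ∧ π j < π k ∧ π k < π i} = 0 := by
    rw [card_eq_zero, filter_eq_empty_iff]
    rintro k - ⟨⟨h1, h2⟩, -⟩
    rw [Fin.lt_def] at h1 h2
    omega
  have := inversionCount_eq_mul_swap π (Fin.lt_def.mpr (by omega)) h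
  omega

/-! ### Length is the number of inversions -/

theorem inversionCount_mul_adjacent_le {n : ℕ} (π : Perm (Fin n)) {s : Perm (Fin n)}
    (hs : s ∈ adjacentTranspositions n) : inversionCount (π * s) ≤ inversionCount π + 1 := by
  obtain ⟨i, j, hij, rfl⟩ := hs
  have hlt : i < j := Fin.lt_def.mpr (by omega)
  rcases lt_or_gt_of_ne (π.injective.ne hlt.ne) with h | h
  · have := inversionCount_mul_swap_of_descent (π * swap i j) hij (by simpa using h)
    rw [mul_assoc, swap_mul_self, mul_one] at this
    omega
  · have := inversionCount_mul_swap_of_descent π hij h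
    omega

theorem inversionCount_one {n : ℕ} : inversionCount (1 : Perm (Fin n)) = 0 := by
  rw [inversionCount, card_eq_zero, filter_eq_empty_iff]
  rintro p - ⟨h1, h2⟩
  exact lt_asymm h1 h2

theorem inversionCount_prod_le {n : ℕ} (w : List (Perm (Fin n)))
    (hw : ∀ s ∈ w, s ∈ adjacentTranspositions n) : inversionCount w.prod ≤ w.length := by
  induction w using List.reverseRecOn with
  | nil => simp [inversionCount_one]
  | append_singleton w s ih =>
    have h1 := ih fun t ht => hw t (by simp [ht])
    have h2 := inversionCount_mul_adjacent_le w.prod (hw s (by simp))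
    simp only [List.prod_append, List.prod_singleton, List.length_append, List.length_singleton]
    omega

theorem exists_adjacent_descent {n : ℕ} {π : Perm (Fin n)} (hπ : π ≠ 1) :
    ∃ i j : Fin n, i.val + 1 = j.val ∧ π j < π i := by
  contrapose! hπ
  cases n with
  | zero => exact Subsingleton.elim _ _
  | succ n =>
    have hmono : StrictMono π := Fin.strictMono_iff_lt_succ.mpr fun i =>
      lt_of_le_of_ne (hπ i.castSucc i.succ (by simp))
        (π.injective.ne (Fin.castSucc_lt_succ (i := i)).ne)
    have := Subsingleton.elim (hmono.orderIsoOfSurjective π π.surjective) (OrderIso.refl _)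
    ext i
    exact congrArg Fin.val (DFunLike.congr_fun this i)

/-- Bubble sort: swapping adjacent descents writes `π` as a word with one letter per inversion. -/
theorem exists_adjacent_word {n : ℕ} (m : ℕ) (π : Perm (Fin n)) (hm : inversionCount π = m) :
    ∃ w : List (Perm (Fin n)),
      w.length = m ∧ (∀ s ∈ w, s ∈ adjacentTranspositions n) ∧ w.prod = π := by
  induction m generalizing π with
  | zero =>
    refine ⟨[], rfl, by simp, ?_⟩
    by_contra hne
    obtain ⟨i, j, hij, h⟩ := exists_adjacent_descent (π := π) (Ne.symm hne)
    have := inversionCount_mul_swap_of_descent π hij h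
    omega
  | succ m ih =>
    have hne : π ≠ 1 := by
      rintro rfl
      rw [inversionCount_one] at hm
      omega
    obtain ⟨i, j, hij, h⟩ := exists_adjacent_descent hne
    have hc := inversionCount_mul_swap_of_descent π hij h
    obtain ⟨w, hl, hw, hp⟩ := ih (π * swap i j) (by omega)
    refine ⟨w ++ [swap i j], by simp [hl], ?_, by simp [hp, mul_assoc]⟩
    intro s hs
    rcases List.mem_append.mp hs with hs | hs
    · exact hw s hs
    · exact ⟨i, j, hij, List.mem_singleton.mp hs⟩

theorem coxeterLength_eq_inversionCount {n : ℕ} (π : Perm (Fin n)) :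
    coxeterLength π = inversionCount π := by
  refine le_antisymm (Nat.sInf_le (exists_adjacent_word _ π rfl)) ?_
  refine le_csInf ⟨_, exists_adjacent_word _ π rfl⟩ ?_
  rintro _ ⟨w, rfl, hw, rfl⟩
  exact inversionCount_prod_le w hw

/-! ### Covers in the strong Bruhat order -/

/-- Swapping two values of `π` is the same as swapping the two positions that carry them; in
positional form a step down is the swap of an inversion. -/
theorem bruhatStep_iff {n : ℕ} {σ π : Perm (Fin n)} :
    BruhatStep σ π ↔ ∃ i j : Fin n, i < j ∧ π j < π i ∧ σ = π * swap i j := by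
  constructor
  · rintro ⟨a, b, rfl, hlt⟩
    rw [coxeterLength_eq_inversionCount, coxeterLength_eq_inversionCount] at hlt
    have hσ : σ = swap a b * σ * swap (σ⁻¹ a) (σ⁻¹ b) := by
      rw [swap_mul_eq_mul_swap, mul_assoc, swap_mul_self, mul_one]
    generalize swap a b * σ = π at *
    generalize σ⁻¹ a = i at *
    generalize σ⁻¹ b = j at *
    subst hσ
    rcases lt_trichotomy i j with h | rfl | h
    · exact ⟨i, j, h, (inversionCount_mul_swap_lt_iff π h).mp hlt, rfl⟩
    · rw [swap_self] at hlt
      exact (lt_irrefl _ hlt).elim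
    · rw [swap_comm] at hlt
      exact ⟨j, i, h, (inversionCount_mul_swap_lt_iff π h).mp hlt, by rw [swap_comm]⟩
  · rintro ⟨i, j, hij, h, rfl⟩
    refine ⟨π i, π j, ?_, ?_⟩
    · rw [← mul_assoc, swap_mul_eq_mul_swap]
      simp [mul_assoc]
    · rw [coxeterLength_eq_inversionCount, coxeterLength_eq_inversionCount]
      exact inversionCount_mul_swap_lt π hij h

theorem StrongBruhatLT.inversionCount_lt {n : ℕ} {σ π : Perm (Fin n)}
    (h : StrongBruhatLT σ π) : inversionCount σ < inversionCount π := by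
  have hstep : ∀ {σ π : Perm (Fin n)}, BruhatStep σ π → inversionCount σ < inversionCount π := by
    rintro σ π ⟨-, -, -, hlt⟩
    simpa only [coxeterLength_eq_inversionCount] using hlt
  induction h with
  | single h => exact hstep h
  | tail _ h ih => exact ih.trans (hstep h)

/-- `b` lies immediately below `a` among the elements of `S`, when these are ordered by their
values under `π`. -/
def IsValuePredIn {n : ℕ} (S : Finset (Fin n)) (π : Perm (Fin n)) (b a : Fin n) : Prop :=
  π b < π a ∧ ∀ k ∈ S, ¬ (π b < π k ∧ π k < π a)

instance {n : ℕ} (S : Finset (Fin n)) (π : Perm (Fin n)) (b a : Fin n) :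
    Decidable (IsValuePredIn S π b a) :=
  inferInstanceAs (Decidable (_ ∧ _))

/-- The covers below `π` come from the inversions with no intermediate value at an intermediate
position. Within `Icc i j` the endpoints never carry a value strictly between `π j` and `π i`. -/
theorem strongBruhatCovers_iff {n : ℕ} {σ π : Perm (Fin n)} :
    StrongBruhatCovers π σ ↔
      ∃ i j : Fin n, i < j ∧ IsValuePredIn (Icc i j) π j i ∧ σ = π * swap i j := by
  constructor
  · rintro ⟨hlt, hno⟩
    have hstep : BruhatStep σ π := by
      cases hlt with
      | single h => exact h
      | tail h₁ h₂ => exact (hno ⟨_, h₁, .single h₂⟩).elim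
    obtain ⟨i, j, hij, h, rfl⟩ := bruhatStep_iff.mp hstep
    refine ⟨i, j, hij, ⟨h, fun k hk hjk => hno ?_⟩, rfl⟩
    have hik : i < k := lt_of_le_of_ne (mem_Icc.mp hk).1 fun h => by simp [h] at hjk
    have hkj : k < j := lt_of_le_of_ne (mem_Icc.mp hk).2 fun h => by simp [h] at hjk
    -- With values `c, b, a` (where `a < b < c`) at positions `i, k, j`, go down along
    -- `c b a → b c a → a c b → a b c`.
    have hτ := hik.ne
    have hτ' := hkj.ne
    have hτ'' := hij.ne
    refine ⟨π * swap i k, .tail (b := π * swap i k * swap i j)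
      (.single (bruhatStep_iff.mpr ⟨k, j, hkj, ?_, ?_⟩)) (bruhatStep_iff.mpr ⟨i, j, hij, ?_, rfl⟩),
      .single (bruhatStep_iff.mpr ⟨i, k, hik, hjk.2, rfl⟩)⟩
    · simp only [Perm.mul_apply, swap_apply_def]
      grind
    · ext x
      simp only [Perm.mul_apply, swap_apply_def]
      grind
    · simp only [Perm.mul_apply, swap_apply_def]
      grind
  · rintro ⟨i, j, hij, ⟨h, hk⟩, rfl⟩
    refine ⟨.single (bruhatStep_iff.mpr ⟨i, j, hij, h, rfl⟩), ?_⟩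
    rintro ⟨τ, h₁, h₂⟩
    have hempty : #{k : Fin n | (i < k ∧ k < j) ∧ π j < π k ∧ π k < π i} = 0 := by
      rw [card_eq_zero, filter_eq_empty_iff]
      rintro k - ⟨⟨h1, h2⟩, h3⟩
      exact hk k (mem_Icc.mpr ⟨h1.le, h2.le⟩) h3
    have := inversionCount_eq_mul_swap π hij h
    have := h₁.inversionCount_lt
    have := h₂.inversionCount_lt
    omega

theorem swap_injective_of_lt {n : ℕ} {i j i' j' : Fin n} (h : i < j) (h' : i' < j')
    (heq : swap i j = swap i' j') : i = i' ∧ j = j' := by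
  have h1 := congrArg (fun f : Perm (Fin n) => f i) heq
  have h2 := congrArg (fun f : Perm (Fin n) => f j) heq
  simp only [swap_apply_def] at h1 h2
  grind

theorem downDegree_eq_sum {n : ℕ} (π : Perm (Fin n)) :
    downDegree π = ∑ i : Fin n, ∑ j : Fin n,
      if i < j ∧ IsValuePredIn (Icc i j) π j i then 1 else 0 := by
  classical
  have himage : {σ : Perm (Fin n) | StrongBruhatCovers π σ} =
      (({p : Fin n × Fin n | p.1 < p.2 ∧ IsValuePredIn (Icc p.1 p.2) π p.2 p.1} :
        Finset (Fin n × Fin n)).image fun p => π * swap p.1 p.2 : Finset (Perm (Fin n))) := by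
    ext σ
    simp only [Set.mem_ofPred_eq, strongBruhatCovers_iff, coe_image, coe_filter, mem_univ, true_and,
      Set.mem_image, Prod.exists]
    exact ⟨fun ⟨i, j, h, h', e⟩ => ⟨i, j, ⟨h, h'⟩, e.symm⟩,
      fun ⟨i, j, ⟨h, h'⟩, e⟩ => ⟨i, j, h, h', e.symm⟩⟩
  rw [downDegree, himage, Set.ncard_coe_finset, card_image_of_injOn, card_filter,
    Fintype.sum_prod_type]
  rintro ⟨i, j⟩ h ⟨i', j'⟩ h' heq
  simp only [coe_filter, mem_univ, true_and, Set.mem_ofPred_eq] at h h'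
  obtain ⟨rfl, rfl⟩ := swap_injective_of_lt h.1 h'.1 (mul_left_cancel heq)
  rfl

/-! ### The probability of an immediate predecessor -/

/-- Precomposing with the swap of `a` and `a'` exchanges the permutations that are minimal on `S` at
`a` with those that are minimal at `a'`. -/
theorem card_min_eq {n : ℕ} {S : Finset (Fin n)} {a a' : Fin n} (ha : a ∈ S) (ha' : a' ∈ S) :
    #{π : Perm (Fin n) | ∀ k ∈ S, π a ≤ π k} = #{π : Perm (Fin n) | ∀ k ∈ S, π a' ≤ π k} := by
  refine card_equiv (Equiv.mulRight (swap a a')) fun π => ?_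
  simp only [mem_filter, mem_univ, true_and, Equiv.coe_mulRight, Perm.mul_apply,
    swap_apply_right]
  have hS : ∀ k ∈ S, swap a a' k ∈ S := by
    intro k hk
    rw [swap_apply_def]
    grind
  refine ⟨fun h k hk => h _ (hS k hk), fun h k hk => ?_⟩
  simpa using h _ (hS k hk)

/-- Precomposing with the swap of `b` and `b'` fixes `a` and preserves `S`, so all positions other
than `a` are equally likely to carry the value immediately below the one at `a`. -/
theorem card_isValuePredIn_eq {n : ℕ} {S : Finset (Fin n)} {a b b' : Fin n} (hb : b ∈ S)
    (hb' : b' ∈ S) (hab : b ≠ a) (hab' : b' ≠ a) :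
    #{π : Perm (Fin n) | IsValuePredIn S π b a} = #{π : Perm (Fin n) | IsValuePredIn S π b' a} := by
  refine card_equiv (Equiv.mulRight (swap b b')) fun π => ?_
  rw [mem_filter_univ, mem_filter_univ]
  simp only [Equiv.coe_mulRight, Perm.mul_apply, IsValuePredIn, swap_apply_right, swap_apply_of_ne_of_ne hab.symm hab'.symm]
  have hS : ∀ k ∈ S, swap b b' k ∈ S := by
    intro k hk
    rw [swap_apply_def]
    grind
  refine and_congr_right fun _ => ⟨fun h k hk => h _ (hS k hk), fun h k hk => ?_⟩
  simpa using h _ (hS k hk)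

theorem card_mul_card_min {n : ℕ} {S : Finset (Fin n)} {a : Fin n} (ha : a ∈ S) :
    #S * #{π : Perm (Fin n) | ∀ k ∈ S, π a ≤ π k} = n.factorial := by
  have hone : ∀ π : Perm (Fin n), ∑ c ∈ S, (if ∀ k ∈ S, π c ≤ π k then 1 else 0) = 1 := by
    intro π
    obtain ⟨c, hc, hmin⟩ := S.exists_min_image π ⟨a, ha⟩
    rw [sum_eq_single_of_mem c hc, if_pos hmin]
    intro d hd hne
    exact if_neg fun h => hne (π.injective (le_antisymm (h c hc) (hmin d hd)))
  calc #S * #{π : Perm (Fin n) | ∀ k ∈ S, π a ≤ π k}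
      = ∑ c ∈ S, #{π : Perm (Fin n) | ∀ k ∈ S, π c ≤ π k} := by
        rw [sum_congr rfl fun c hc => card_min_eq hc ha, sum_const, smul_eq_mul]
    _ = ∑ π : Perm (Fin n), ∑ c ∈ S, (if ∀ k ∈ S, π c ≤ π k then 1 else 0) := by
        simp_rw [card_filter]
        exact sum_comm
    _ = n.factorial := by
        simp [hone, Fintype.card_perm]

/-- Either `π a` is the minimum of `π` on `S`, or exactly one position of `S` carries the value
immediately below `π a`. -/
theorem sum_isValuePredIn_add_min {n : ℕ} {S : Finset (Fin n)} {a : Fin n} (ha : a ∈ S)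
    (π : Perm (Fin n)) :
    (∑ b ∈ S.erase a, if IsValuePredIn S π b a then 1 else 0) +
      (if ∀ k ∈ S, π a ≤ π k then 1 else 0) = 1 := by
  by_cases hmin : ∀ k ∈ S, π a ≤ π k
  · rw [if_pos hmin, sum_eq_zero]
    intro b hb
    exact if_neg fun h => (hmin b (mem_of_mem_erase hb)).not_gt h.1
  · rw [if_neg hmin, add_zero]
    push Not at hmin
    obtain ⟨k, hk, hka⟩ := hmin
    obtain ⟨b, hb, hmax⟩ := (S.filter fun k => π k < π a).exists_max_image π
      ⟨k, mem_filter.mpr ⟨hk, hka⟩⟩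
    rw [mem_filter] at hb
    have hne : b ≠ a := by
      rintro rfl
      exact lt_irrefl _ hb.2
    rw [sum_eq_single_of_mem b (mem_erase.mpr ⟨hne, hb.1⟩), if_pos]
    · exact ⟨hb.2, fun k hk h => (hmax k (mem_filter.mpr ⟨hk, h.2⟩)).not_gt h.1⟩
    · intro c hc hcb
      refine if_neg fun h => ?_
      have hcS := mem_of_mem_erase hc
      have hlt : π c < π b := lt_of_le_of_ne (hmax c (mem_filter.mpr ⟨hcS, h.1⟩))
        (π.injective.ne hcb)
      exact h.2 b hb.1 ⟨hlt, hb.2⟩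

/-- For a uniformly random `π`, the position `b` carries the value immediately below that at `a`,
among the positions in `S`, with probability `1 / #S`. -/
theorem card_mul_card_isValuePredIn {n : ℕ} {S : Finset (Fin n)} {a b : Fin n} (ha : a ∈ S)
    (hb : b ∈ S) (hab : b ≠ a) :
    #S * #{π : Perm (Fin n) | IsValuePredIn S π b a} = n.factorial := by
  have hsum : (#S - 1) * #{π : Perm (Fin n) | IsValuePredIn S π b a} +
      #{π : Perm (Fin n) | ∀ k ∈ S, π a ≤ π k} = n.factorial := by
    calc (#S - 1) * #{π : Perm (Fin n) | IsValuePredIn S π b a} +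
          #{π : Perm (Fin n) | ∀ k ∈ S, π a ≤ π k}
        = ∑ c ∈ S.erase a, #{π : Perm (Fin n) | IsValuePredIn S π c a} +
          #{π : Perm (Fin n) | ∀ k ∈ S, π a ≤ π k} := by
          rw [sum_congr rfl fun c hc => card_isValuePredIn_eq (mem_of_mem_erase hc) hb
            (ne_of_mem_erase hc) hab, sum_const, smul_eq_mul, card_erase_of_mem ha]
      _ = ∑ π : Perm (Fin n), ((∑ c ∈ S.erase a, if IsValuePredIn S π c a then 1 else 0) +
          (if ∀ k ∈ S, π a ≤ π k then 1 else 0)) := by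
          simp_rw [card_filter]
          rw [sum_add_distrib, sum_comm]
      _ = n.factorial := by
          simp_rw [sum_isValuePredIn_add_min ha]
          simp [Fintype.card_perm]
  have hmin := card_mul_card_min ha
  have hcard : 2 ≤ #S := one_lt_card.mpr ⟨b, hb, a, ha, hab⟩
  obtain ⟨m, hm⟩ : ∃ m, #S = m + 2 := ⟨#S - 2, by omega⟩
  rw [hm, show m + 2 - 1 = m + 1 by omega] at hsum
  rw [hm] at hmin ⊢
  -- With `N` the count and `M` the number of `π` minimal at `a`: `(m + 1) N + M = (m + 2) M`.
  have hNM : #{π : Perm (Fin n) | IsValuePredIn S π b a} =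
      #{π : Perm (Fin n) | ∀ k ∈ S, π a ≤ π k} := by
    refine Nat.eq_of_mul_eq_mul_left (Nat.succ_pos m) ?_
    simp only [Nat.succ_eq_add_one]
    linarith
  rw [hNM, hmin]

theorem sum_downDegree (n : ℕ) :
    (∑ π : Perm (Fin n), (downDegree π : ℝ)) = n.factorial *
      ∑ j : Fin n, ∑ i : Fin n, if i < j then 1 / (((j : ℕ) : ℝ) - (i : ℕ) + 1) else 0 := by
  simp_rw [downDegree_eq_sum]
  push_cast
  rw [sum_comm, mul_sum, sum_congr rfl fun i _ => sum_comm, sum_comm]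
  refine sum_congr rfl fun j _ => ?_
  rw [mul_sum]
  refine sum_congr rfl fun i _ => ?_
  by_cases hij : i < j
  · have hN := card_mul_card_isValuePredIn (S := Icc i j) (left_mem_Icc.mpr hij.le)
      (right_mem_Icc.mpr hij.le) hij.ne'
    have hlt : (i : ℕ) < j := hij
    have hcard : ((#(Icc i j) : ℕ) : ℝ) = ((j : ℕ) : ℝ) - (i : ℕ) + 1 := by
      rw [Fin.card_Icc, Nat.cast_sub (by omega)]
      push_cast
      ring
    have hpos : ((j : ℕ) : ℝ) - (i : ℕ) + 1 ≠ 0 := by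
      have : ((i : ℕ) : ℝ) < (j : ℕ) := by exact_mod_cast hlt
      linarith
    simp only [hij, true_and, if_true]
    rw [← hN, sum_boole]
    push_cast
    rw [hcard]
    field_simp
  · simp [hij]

/-! ### Harmonic sums -/

theorem sum_one_div_sub_add_one (m : ℕ) :
    ∑ i ∈ range m, 1 / ((m : ℝ) - i + 1) = ∑ i ∈ Icc 1 (m + 1), 1 / (i : ℝ) - 1 := by
  have h (m : ℕ) : ∑ i ∈ range m, 1 / ((i : ℝ) + 2) = ∑ i ∈ Icc 1 (m + 1), 1 / (i : ℝ) - 1 := by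
    induction m with
    | zero => simp
    | succ m ih =>
      rw [sum_range_succ, ih, sum_Icc_succ_top (by omega : 1 ≤ m + 1 + 1)]
      push_cast
      ring
  rw [← h, ← sum_range_reflect]
  refine sum_congr rfl fun i hi => ?_
  rw [mem_range] at hi
  rw [Nat.sub_sub, Nat.cast_sub (by omega)]
  push_cast
  ring

theorem sum_harmonic (n : ℕ) :
    ∑ j ∈ range n, (∑ i ∈ Icc 1 (j + 1), 1 / (i : ℝ) - 1) =
      ((n : ℝ) + 1) * (∑ i ∈ Icc 1 n, 1 / (i : ℝ)) - 2 * n := by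
  induction n with
  | zero => simp
  | succ n ih =>
    rw [sum_range_succ, ih, sum_Icc_succ_top (by omega)]
    push_cast
    field_simp
    ring

theorem sum_sum_lt_one_div (n : ℕ) :
    (∑ j : Fin n, ∑ i : Fin n, if i < j then 1 / (((j : ℕ) : ℝ) - (i : ℕ) + 1) else 0) =
      ((n : ℝ) + 1) * (∑ i ∈ Icc 1 n, 1 / (i : ℝ)) - 2 * n := by
  rw [← sum_harmonic, ← Fin.sum_univ_eq_sum_range
    (fun j => ∑ i ∈ Icc 1 (j + 1), 1 / (i : ℝ) - 1)]
  refine sum_congr rfl fun j _ => ?_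
  rw [← sum_one_div_sub_add_one]
  have := Fin.sum_univ_eq_sum_range
    (fun i : ℕ => if i < (j : ℕ) then 1 / (((j : ℕ) : ℝ) - i + 1) else 0) n
  simp only [Fin.lt_def]
  rw [this, ← sum_filter]
  refine sum_congr ?_ fun _ _ => rfl
  ext x
  simp only [mem_filter, mem_range]
  omega

theorem sum_Icc_two_one_div_sub_one (j : ℕ) :
    ∑ k ∈ Icc 2 (j + 1), 1 / ((k : ℝ) - 1) = ∑ i ∈ Icc 1 j, 1 / (i : ℝ) := by
  induction j with
  | zero => simp
  | succ j ih =>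
    rw [sum_Icc_succ_top (by omega : 2 ≤ j + 1 + 1), ih,
      sum_Icc_succ_top (by omega : 1 ≤ j + 1)]
    push_cast
    ring_nf

theorem sum_sum_Icc_two (i : ℕ) :
    ∑ j ∈ Icc 2 (i + 1), ∑ k ∈ Icc 2 j, 1 / ((k : ℝ) - 1) =
      ((i : ℝ) + 1) * (∑ k ∈ Icc 1 (i + 1), 1 / (k : ℝ) - 1) := by
  induction i with
  | zero => simp
  | succ i ih =>
    rw [sum_Icc_succ_top (by omega), ih, sum_Icc_two_one_div_sub_one,
      sum_Icc_succ_top (by omega : 1 ≤ i + 1 + 1)]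
    push_cast
    field_simp
    ring

theorem triple_sum_eq (n : ℕ) :
    ∑ i ∈ Icc 2 n, ∑ j ∈ Icc 2 i, ∑ k ∈ Icc 2 j, 1 / ((i : ℝ) * ((k : ℝ) - 1)) =
      ((n : ℝ) + 1) * (∑ i ∈ Icc 1 n, 1 / (i : ℝ)) - 2 * (n : ℝ) := by
  rw [← sum_harmonic]
  induction n with
  | zero => simp
  | succ n ih =>
    rw [sum_range_succ, ← ih]
    have hterm : ∑ j ∈ Icc 2 (n + 1), ∑ k ∈ Icc 2 j, 1 / (((n + 1 : ℕ) : ℝ) * ((k : ℝ) - 1)) =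
        ∑ i ∈ Icc 1 (n + 1), 1 / (i : ℝ) - 1 := by
      simp_rw [← one_div_mul_one_div, ← mul_sum]
      rw [sum_sum_Icc_two]
      push_cast
      field_simp
    rcases n with _ | n
    · simp
    · rw [sum_Icc_succ_top (by omega), hterm]

/-- The expectation over a uniformly random permutation is Mathlib's average `𝔼 π, f π`. -/
theorem theorem4p1 (n : ℕ) (hn : 1 ≤ n) :
    (𝔼 π : Equiv.Perm (Fin n), (downDegree π : ℝ)) =
        ∑ i ∈ Finset.Icc 2 n, ∑ j ∈ Finset.Icc 2 i, ∑ k ∈ Finset.Icc 2 j,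
          1 / ((i : ℝ) * ((k : ℝ) - 1)) ∧
      ∑ i ∈ Finset.Icc 2 n, ∑ j ∈ Finset.Icc 2 i, ∑ k ∈ Finset.Icc 2 j,
          1 / ((i : ℝ) * ((k : ℝ) - 1)) =
        ((n : ℝ) + 1) * (∑ i ∈ Finset.Icc 1 n, 1 / (i : ℝ)) - 2 * (n : ℝ) := by
  refine ⟨?_, triple_sum_eq n⟩
  rw [triple_sum_eq, Fintype.expect_eq_sum_div_card, sum_downDegree, sum_sum_lt_one_div,
    Fintype.card_perm, Fintype.card_fin]
  exact mul_div_cancel_left₀ _ (by exact_mod_cast n.factorial_ne_zero)
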